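/- Let $K=\mathbb{F}_{q^n}$ be a finite field, let $\sigma$ be an automorphism of $K$ with fixed field $\mathbb{F}_q$, and let $R=K[t;\sigma]$ be the skew polynomial ring, in which addition is termwise and multiplication is determined by $ta=a^{\sigma}t$ for all $a\in K$. Let $f\in R$ have degree $d\ge 0$ and be irreducible, meaning that there are no $a,b\in R$ with $\deg(a),\deg(b)<\deg(f)$ and $f=ab$ (where $\deg 0=-\infty$). If $n>1$, assume also that $t$ does not right-divide $f$ (equivalently, that $f$ is not of the form $\alpha t$ with $\alpha\in K\setminus\{0\}$). Say that $f$ right-divides $g$ if $g=vf$ for some $v\in R$. Then the eigenring $$E(f)=\{u\in R : \deg(u)<d,\ f \text{ right-divides } fu\}$$ has exactly $q^d$ elements. -/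

import Mathlib

namespace SkewPolynomial

/-- The degree of a skew polynomial, with value `⊥` (minus infinity) at the zero polynomial. -/
def degree {K : Type*} [Semiring K] (p : SkewPolynomial K) : WithBot ℕ :=
  p.support.max

section

variable {K : Type*} [Ring K] [MulSemiringAction (Multiplicative ℕ) K]

/-- `f` is irreducible if it is not a product of two elements of strictly smaller degree. -/
def IsIrreducible (f : SkewPolynomial K) : Prop :=
  ¬ ∃ a b : SkewPolynomial K, a.degree < f.degree ∧ b.degree < f.degree ∧ f = a * b

/-- `f` right-divides `g`: `g` lies in the left ideal `R f`. -/
def RightDvd (f g : SkewPolynomial K) : Prop :=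
  ∃ v : SkewPolynomial K, g = v * f

/-- The eigenring of `f`. -/
def eigenring (f : SkewPolynomial K) : Set (SkewPolynomial K) :=
  {u | u.degree < f.degree ∧ RightDvd f (f * u)}

end

/-- The subfield of `K` of elements fixed by `σ`. -/
def fixedSubfield {K : Type*} [Field K] (σ : K ≃+* K) : Subfield K :=
  RingHom.eqLocusField (σ : K →+* K) (RingHom.id K)

end SkewPolynomial

/-! Let `V = R/Rf`, of order `|K|^d = q^(nd)`, and `D = End_R(V)`. Sending an endomorphism to the
image of 1 identifies `D` with the classes killed by `f`, hence with `E(f)`. If `n = 1` then `R` is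
commutative, and `d = 0` is trivial. Otherwise `V` is simple, so `D` is a finite division ring, and
a field by Wedderburn. It is enough to show `|V| = |D|^n`.

Let `h`, monic of degree `e`, generate the annihilator of `V`. The assumption on `t` makes `t` act
injectively, so `h` has nonzero constant term; comparing `h a` with `a h` then gives `σ^e = id`, so
`e = n l`. By Jacobson density the polynomials of degree less than `e` represent `End_D(V)` exactly
once, which gives order `q^(n·nl)`; those that act as elements of `D` are the central ones, and
there are `q^l` of them. With `m = dim_D V` this gives `n·n·l = l·m·m`, so `m = n`. The counts are
`card_end_end`, `card_end` and `prod_centralCoeff`. -/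

namespace SkewPolynomial

/-! ### Coefficients, right division and left ideals -/

section Coefficients

variable {K : Type*} [Field K] [MulSemiringAction (Multiplicative ℕ) K]

/-- The coefficient map as an additive homomorphism. -/
noncomputable def coeffHom {K : Type*} [Semiring K] (k : ℕ) : SkewPolynomial K →+ K where
  toFun p := p.coeff k
  map_zero' := coeff_zero k
  map_add' p q := coeff_add p q k

theorem coeff_sum_finset {K : Type*} [Semiring K] {ι : Type*} (s : Finset ι)
    (p : ι → SkewPolynomial K) (k : ℕ) :
    (∑ i ∈ s, p i).coeff k = ∑ i ∈ s, (p i).coeff k :=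
  map_sum (coeffHom k) p s

theorem coeff_mul_antidiagonal (p q : SkewPolynomial K) (k : ℕ) :
    (p * q).coeff k = ∑ x ∈ Finset.HasAntidiagonal.antidiagonal k, p.coeff x.1 * (φ^[x.1] (q.coeff x.2)) := by
  induction p using SkewPolynomial.induction with
  | h0 => simp
  | ha n r p hn hr ih =>
    rw [add_mul, coeff_add, ih]
    simp only [coeff_add, add_mul, Finset.sum_add_distrib]
    congr 1
    clear ih hn
    induction q using SkewPolynomial.induction with
    | h0 => simp
    | ha m s q hm hs ih =>
      rw [mul_add, coeff_add, ih]
      simp only [coeff_add, iterate_map_add, mul_add, Finset.sum_add_distrib]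
      congr 1
      rw [monomial_mul_monomial]
      simp only [coeff_monomial]
      by_cases h : n + m = k
      · rw [if_pos h, Finset.sum_eq_single (n, m)]
        · simp
        · rintro ⟨a, b⟩ hab hne
          rw [Finset.HasAntidiagonal.mem_antidiagonal] at hab
          by_cases ha : n = a
          · have hb : m ≠ b := by rintro rfl; exact hne (by rw [ha])
            simp [hb]
          · simp [ha]
        · intro h'; simp [h] at h'
      · rw [if_neg h, Finset.sum_eq_zero]
        rintro ⟨a, b⟩ hab
        rw [Finset.HasAntidiagonal.mem_antidiagonal] at hab
        by_cases ha : n = a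
        · have hb : m ≠ b := by rintro rfl; exact h (by rw [ha]; exact hab)
          simp [hb]
        · simp [ha]

theorem coeff_C_mul (a : K) (p : SkewPolynomial K) (k : ℕ) :
    (C a * p).coeff k = a * p.coeff k := by
  rw [coeff_mul_antidiagonal, Finset.sum_eq_single (0, k)]
  · simp
  · rintro ⟨i, j⟩ hij hne
    have hi : i ≠ 0 := by
      rintro rfl
      simp at hij
      exact hne (by rw [hij])
    simp [coeff_C_ne_zero hi]
  · simp

theorem coeff_mul_C (p : SkewPolynomial K) (a : K) (k : ℕ) :
    (p * C a).coeff k = p.coeff k * φ^[k] a := by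
  rw [coeff_mul_antidiagonal, Finset.sum_eq_single (k, 0)]
  · simp
  · rintro ⟨i, j⟩ hij hne
    have hj : j ≠ 0 := by
      rintro rfl
      simp at hij
      exact hne (by rw [hij])
    simp [coeff_C_ne_zero hj]
  · simp

theorem coeff_X_mul_succ (p : SkewPolynomial K) (k : ℕ) :
    (X * p).coeff (k + 1) = φ (p.coeff k) := by
  rw [coeff_mul_antidiagonal, Finset.sum_eq_single (1, k)]
  · simp
  · rintro ⟨i, j⟩ hij hne
    have hi : i ≠ 1 := by
      rintro rfl
      rw [Finset.HasAntidiagonal.mem_antidiagonal] at hij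
      exact hne (by congr; omega)
    simp [coeff_X_of_ne_one hi]
  · intro h; exact absurd (Finset.HasAntidiagonal.mem_antidiagonal.2 (by omega)) h

theorem coeff_X_mul_zero (p : SkewPolynomial K) : (X * p).coeff 0 = 0 := by
  simp [coeff_mul_antidiagonal]

theorem coeff_mul_X_succ (p : SkewPolynomial K) (k : ℕ) :
    (p * X).coeff (k + 1) = p.coeff k := by
  rw [coeff_mul_antidiagonal, Finset.sum_eq_single (k, 1)]
  · simp
  · rintro ⟨i, j⟩ hij hne
    have hj : j ≠ 1 := by
      rintro rfl
      rw [Finset.HasAntidiagonal.mem_antidiagonal] at hij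
      exact hne (by congr; omega)
    simp [coeff_X_of_ne_one hj]
  · intro h; exact absurd (Finset.HasAntidiagonal.mem_antidiagonal.2 (by omega)) h

theorem coeff_mul_X_zero (p : SkewPolynomial K) : (p * X).coeff 0 = 0 := by
  simp [coeff_mul_antidiagonal]

theorem φ_iterate_eq_zero_iff (i : ℕ) {a : K} : φ^[i] a = 0 ↔ a = 0 := by
  constructor
  · intro h
    exact (φ (R := K)).injective.iterate i (by rw [h, iterate_map_zero])
  · rintro rfl
    exact iterate_map_zero _ _

/-- All coefficients of `p` of index at least `d` vanish. -/
def DegLT {K : Type*} [Semiring K] (p : SkewPolynomial K) (d : ℕ) : Prop :=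
  ∀ i, d ≤ i → p.coeff i = 0

theorem degree_lt_iff {K : Type*} [Semiring K] {p : SkewPolynomial K} {d : ℕ} :
    p.degree < (d : WithBot ℕ) ↔ DegLT p d := by
  unfold degree
  rw [Finset.max_eq_sup_withBot]
  refine (Finset.sup_lt_iff (WithBot.bot_lt_coe d)).trans ?_
  constructor
  · intro h i hi
    by_contra h0
    exact absurd (WithBot.coe_lt_coe.1 (h i (mem_support_iff.2 h0))) (by simpa using hi)
  · intro h i hi
    refine WithBot.coe_lt_coe.2 ?_
    by_contra h0
    exact mem_support_iff.1 hi (h i (by simpa using h0))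

theorem degree_eq_coe_iff {K : Type*} [Semiring K] {p : SkewPolynomial K} {d : ℕ} :
    p.degree = (d : WithBot ℕ) ↔ DegLT p (d + 1) ∧ p.coeff d ≠ 0 := by
  constructor
  · intro h
    refine ⟨degree_lt_iff.1 (h ▸ WithBot.coe_lt_coe.2 (Nat.lt_succ_self d)), ?_⟩
    exact mem_support_iff.1 (Finset.mem_of_max h)
  · rintro ⟨h, h0⟩
    refine le_antisymm ?_ (Finset.le_max (mem_support_iff.2 h0))
    refine Finset.max_le fun i hi => WithBot.coe_le_coe.2 ?_
    by_contra hlt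
    exact mem_support_iff.1 hi (h i (by simpa using hlt))

namespace DegLT

variable {p q : SkewPolynomial K} {a b d : ℕ}

omit [MulSemiringAction (Multiplicative ℕ) K] in
theorem mono (h : DegLT p a) (hab : a ≤ b) : DegLT p b := fun i hi => h i (hab.trans hi)

omit [MulSemiringAction (Multiplicative ℕ) K] in
theorem sub (hp : DegLT p a) (hq : DegLT q a) : DegLT (p - q) a := fun i hi => by
  rw [coeff_sub, hp i hi, hq i hi, sub_zero]

omit [MulSemiringAction (Multiplicative ℕ) K] in
theorem eq_zero (h : DegLT p 0) : p = 0 := SkewPolynomial.ext fun i => h i (Nat.zero_le i)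

omit [MulSemiringAction (Multiplicative ℕ) K] in
theorem of_succ (h : DegLT p (d + 1)) (h0 : p.coeff d = 0) : DegLT p d := fun i hi => by
  rcases hi.eq_or_lt with rfl | hi
  · exact h0
  · exact h i hi

theorem mul (hp : DegLT p (a + 1)) (hq : DegLT q (b + 1)) : DegLT (p * q) (a + b + 1) := by
  intro i hi
  rw [coeff_mul_antidiagonal]
  refine Finset.sum_eq_zero ?_
  rintro ⟨x, y⟩ hxy
  rw [Finset.HasAntidiagonal.mem_antidiagonal] at hxy
  dsimp only at hxy ⊢
  rcases le_or_gt (a + 1) x with h | h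
  · rw [hp x h, zero_mul]
  · rw [hq y (by omega), iterate_map_zero, mul_zero]

theorem coeff_mul (hp : DegLT p (a + 1)) (hq : DegLT q (b + 1)) :
    (p * q).coeff (a + b) = p.coeff a * φ^[a] (q.coeff b) := by
  rw [coeff_mul_antidiagonal]
  refine Finset.sum_eq_single_of_mem (a, b) (Finset.HasAntidiagonal.mem_antidiagonal.2 rfl) ?_
  rintro ⟨x, y⟩ hxy hne
  rw [Finset.HasAntidiagonal.mem_antidiagonal] at hxy
  dsimp only at hxy ⊢
  rcases le_or_gt (a + 1) x with h | h
  · rw [hp x h, zero_mul]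
  · have : x ≠ a := by
      rintro rfl
      exact hne (by congr; omega)
    rw [hq y (by omega), iterate_map_zero, mul_zero]

end DegLT

theorem degLT_monomial {K : Type*} [Semiring K] (i : ℕ) (a : K) : DegLT (monomial i a) (i + 1) := fun j hj => by
  rw [coeff_monomial, if_neg (by omega)]

theorem exists_degLT {K : Type*} [Semiring K] (p : SkewPolynomial K) : ∃ N, DegLT p N := by
  refine ⟨p.support.sup id + 1, fun i hi => ?_⟩
  by_contra h
  have := Finset.le_sup (f := id) (mem_support_iff.2 h)
  simp only [id] at this
  omega

omit [MulSemiringAction (Multiplicative ℕ) K] in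
theorem exists_degLT_succ {p : SkewPolynomial K} (hp : p ≠ 0) :
    ∃ a, DegLT p (a + 1) ∧ p.coeff a ≠ 0 := by
  classical
  have h := exists_degLT p
  obtain ⟨a, ha⟩ : ∃ a, Nat.find h = a + 1 := by
    refine Nat.exists_eq_succ_of_ne_zero fun h0 => hp ?_
    have h1 : DegLT p 0 := h0 ▸ Nat.find_spec h
    exact h1.eq_zero
  refine ⟨a, ha ▸ Nat.find_spec h, fun h0 => ?_⟩
  have h1 : DegLT p (a + 1) := ha ▸ Nat.find_spec h
  exact Nat.find_min h (m := a) (by omega) (h1.of_succ h0)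

/-- Right division with remainder. -/
theorem exists_eq_mul_add {f : SkewPolynomial K} {d : ℕ} (hf : DegLT f (d + 1))
    (hd : f.coeff d ≠ 0) (g : SkewPolynomial K) :
    ∃ v r, g = v * f + r ∧ DegLT r d := by
  obtain ⟨N, hN⟩ := exists_degLT g
  induction N generalizing g with
  | zero => exact ⟨0, g, by simp, hN.mono (Nat.zero_le d)⟩
  | succ M ih =>
    rcases lt_or_ge M d with h | h
    · exact ⟨0, g, by simp, hN.mono h⟩
    · obtain ⟨j, rfl⟩ := Nat.exists_eq_add_of_le' h
      have hj : φ^[j] (f.coeff d) ≠ 0 := by rwa [Ne, φ_iterate_eq_zero_iff]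
      set m : SkewPolynomial K := monomial j (g.coeff (j + d) / φ^[j] (f.coeff d)) with hm
      have hmd : DegLT m (j + 1) := degLT_monomial _ _
      obtain ⟨v, r, hvr, hr⟩ := ih (g - m * f) <| (hN.sub (hmd.mul hf)).of_succ <| by
        rw [coeff_sub, hmd.coeff_mul hf, hm, coeff_monomial, if_pos rfl, div_mul_cancel₀ _ hj,
          sub_self]
      exact ⟨v + m, r, by rw [add_mul, add_right_comm, ← hvr, sub_add_cancel], hr⟩

theorem eq_zero_of_degLT_mul {f v : SkewPolynomial K} {d : ℕ} (hf : DegLT f (d + 1))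
    (hd : f.coeff d ≠ 0) (h : DegLT (v * f) d) : v = 0 := by
  by_contra hv
  obtain ⟨a, ha, ha0⟩ := exists_degLT_succ hv
  have := ha.coeff_mul hf
  rw [h _ (by omega)] at this
  exact mul_ne_zero ha0 (by rwa [Ne, φ_iterate_eq_zero_iff]) this.symm

/-- Remainders under right division by `f` exist and are unique, so they represent the quotient. -/
theorem bijOn_degLT_quotient {f : SkewPolynomial K} {d : ℕ} (hf : DegLT f (d + 1))
    (hd : f.coeff d ≠ 0) :
    Set.BijOn (Submodule.Quotient.mk (p := (Ideal.span {f} : Ideal (SkewPolynomial K))))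
      {p | DegLT p d} Set.univ := by
  refine ⟨fun _ _ => Set.mem_univ _, ?_, ?_⟩
  · intro p hp r hr h
    obtain ⟨v, hv⟩ := Ideal.mem_span_singleton'.1 ((Submodule.Quotient.eq _).1 h)
    have h0 := eq_zero_of_degLT_mul hf hd (v := v) (hv ▸ DegLT.sub hp hr)
    rw [h0, zero_mul] at hv
    exact sub_eq_zero.1 hv.symm
  · intro x _
    obtain ⟨g, rfl⟩ := Submodule.Quotient.mk_surjective _ x
    obtain ⟨v, r, hg, hr⟩ := exists_eq_mul_add hf hd g
    refine ⟨r, hr, (Submodule.Quotient.eq _).2 (Ideal.mem_span_singleton'.2 ⟨-v, ?_⟩)⟩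
    rw [hg, neg_mul]
    abel

/-- Skew polynomials with prescribed sets of coefficients in degrees below `d`. -/
noncomputable def degLTEquiv {K : Type*} [Semiring K] (d : ℕ) (S : ℕ → Set K) :
    {p : SkewPolynomial K | DegLT p d ∧ ∀ i < d, p.coeff i ∈ S i} ≃ ((i : Fin d) → S i) where
  toFun p i := ⟨p.1.coeff i, p.2.2 i i.2⟩
  invFun c := ⟨∑ i : Fin d, monomial (i : ℕ) (c i : K), by
    constructor
    · intro i hi
      rw [coeff_sum_finset]
      refine Finset.sum_eq_zero fun j _ => ?_
      rw [coeff_monomial, if_neg (by omega)]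
    · intro i hi
      rw [coeff_sum_finset, Finset.sum_eq_single_of_mem (⟨i, hi⟩ : Fin d) (Finset.mem_univ _)]
      · simp [coeff_monomial]
      · intro j _ hj
        rw [coeff_monomial, if_neg (fun h => hj (Fin.ext h))]⟩
  left_inv p := by
    refine Subtype.ext (SkewPolynomial.ext fun i => ?_)
    dsimp only
    rw [coeff_sum_finset]
    by_cases hi : i < d
    · rw [Finset.sum_eq_single_of_mem (⟨i, hi⟩ : Fin d) (Finset.mem_univ _)]
      · simp [coeff_monomial]
      · intro j _ hj
        rw [coeff_monomial, if_neg (fun h => hj (Fin.ext h))]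
    · rw [p.2.1 i (by omega)]
      refine Finset.sum_eq_zero fun j _ => ?_
      rw [coeff_monomial, if_neg (by omega)]
  right_inv c := by
    funext i
    refine Subtype.ext ?_
    dsimp only
    rw [coeff_sum_finset, Finset.sum_eq_single_of_mem i (Finset.mem_univ _)]
    · simp [coeff_monomial]
    · intro j _ hj
      rw [coeff_monomial, if_neg (fun h => hj (Fin.ext h))]

theorem ncard_degLT_coeff {K : Type*} [Semiring K] (d : ℕ) (S : ℕ → Set K) :
    {p : SkewPolynomial K | DegLT p d ∧ ∀ i < d, p.coeff i ∈ S i}.ncard =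
      ∏ i ∈ Finset.range d, (S i).ncard := by
  rw [← Nat.card_coe_set_eq, Nat.card_congr (degLTEquiv d S), Nat.card_pi,
    ← Fin.prod_univ_eq_prod_range (fun i => (S i).ncard)]
  rfl

theorem ncard_degLT {K : Type*} [Semiring K] (d : ℕ) :
    {p : SkewPolynomial K | DegLT p d}.ncard = Nat.card K ^ d := by
  have := ncard_degLT_coeff (K := K) d fun _ => Set.univ
  simpa [Set.ncard_univ] using this

theorem card_quotient_span {f : SkewPolynomial K} {d : ℕ} (hf : DegLT f (d + 1))
    (hd : f.coeff d ≠ 0) :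
    Nat.card (SkewPolynomial K ⧸ (Ideal.span {f} : Ideal (SkewPolynomial K))) =
      Nat.card K ^ d := by
  rw [← ncard_degLT, ← Set.ncard_univ]
  have h := bijOn_degLT_quotient hf hd
  rw [← h.image_eq, h.injOn.ncard_image]

/-- A nonzero left ideal is generated by a monic element of least degree. -/
theorem exists_generator {J : Ideal (SkewPolynomial K)} (hJ : J ≠ ⊥) :
    ∃ h e, DegLT h (e + 1) ∧ h.coeff e = 1 ∧ J = Ideal.span {h} ∧
      ∀ p ∈ J, DegLT p e → p = 0 := by
  classical
  obtain ⟨g, hg, hg0⟩ := Submodule.exists_mem_ne_zero_of_ne_bot hJ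
  have hex : ∃ e, ∃ p ∈ J, DegLT p (e + 1) ∧ p.coeff e ≠ 0 := by
    obtain ⟨a, ha⟩ := exists_degLT_succ hg0
    exact ⟨a, g, hg, ha⟩
  obtain ⟨p, hpJ, hp, hpe⟩ := Nat.find_spec hex
  set e := Nat.find hex with he
  have hmin : ∀ r ∈ J, DegLT r e → r = 0 := by
    intro r hr hre
    by_contra hr0
    obtain ⟨a, ha, ha0⟩ := exists_degLT_succ hr0
    have hae : a < e := by
      by_contra h
      exact ha0 (hre a (by omega))
    exact Nat.find_min hex hae ⟨r, hr, ha, ha0⟩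
  have h1 : (C (p.coeff e)⁻¹ * p).coeff e = 1 := by rw [coeff_C_mul, inv_mul_cancel₀ hpe]
  have hd : DegLT (C (p.coeff e)⁻¹ * p) (e + 1) := fun i hi => by
    rw [coeff_C_mul, hp i hi, mul_zero]
  have hJ' : C (p.coeff e)⁻¹ * p ∈ J := J.mul_mem_left _ hpJ
  refine ⟨_, e, hd, h1, le_antisymm (fun g hg => ?_) ?_, hmin⟩
  · obtain ⟨v, r, hgr, hr⟩ := exists_eq_mul_add hd (by rw [h1]; exact one_ne_zero) g
    have hr0 : r = 0 := hmin r (by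
      rw [← add_sub_cancel_left (v * (C (p.coeff e)⁻¹ * p)) r, ← hgr]
      exact J.sub_mem hg (J.mul_mem_left _ hJ')) hr
    rw [hgr, hr0, add_zero]
    exact Ideal.mem_span_singleton'.2 ⟨v, rfl⟩
  · exact (Ideal.span_singleton_le_iff_mem J).2 hJ'

end Coefficients

end SkewPolynomial

namespace SkewPolynomial

/-! ### Simplicity of the quotient, and central polynomials -/

section Simple

variable {K : Type*} [Field K] [MulSemiringAction (Multiplicative ℕ) K]

theorem eq_C_of_degLT_one {K : Type*} [Semiring K] {p : SkewPolynomial K} (h : DegLT p 1) :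
    p = C (p.coeff 0) := by
  refine SkewPolynomial.ext fun i => ?_
  rcases Nat.eq_zero_or_pos i with rfl | hi
  · simp
  · rw [h i hi, coeff_C_ne_zero hi.ne']

/-- If `p = v * g` has leading index `d` and `g` has leading index `e`, then `v` has leading
index `d - e`. -/
theorem exists_leading_of_eq_mul {p v g : SkewPolynomial K} {d e : ℕ} (hp : DegLT p (d + 1))
    (hpd : p.coeff d ≠ 0) (hg : DegLT g (e + 1)) (hge : g.coeff e ≠ 0) (h : p = v * g) :
    ∃ a, a + e = d ∧ DegLT v (a + 1) ∧ v.coeff a ≠ 0 := by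
  have hv : v ≠ 0 := by
    rintro rfl
    rw [zero_mul] at h
    exact hpd (by rw [h, coeff_zero])
  obtain ⟨a, ha, ha0⟩ := exists_degLT_succ hv
  refine ⟨a, ?_, ha, ha0⟩
  have h1 : p.coeff (a + e) ≠ 0 := by
    rw [h, ha.coeff_mul hg]
    exact mul_ne_zero ha0 (by rwa [Ne, φ_iterate_eq_zero_iff])
  have h2 : DegLT p (a + e + 1) := h ▸ ha.mul hg
  by_contra hne
  rcases lt_or_gt_of_ne hne with hlt | hlt
  · exact hpd (h2 d hlt)
  · exact h1 (hp _ hlt)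

theorem C_inv_mul_C_mul {c : K} (hc : c ≠ 0) (p : SkewPolynomial K) :
    C c⁻¹ * (C c * p) = p := by
  rw [← mul_assoc, ← C_mul, inv_mul_cancel₀ hc, C_1, one_mul]

/-- A larger left ideal is principal, generated by some `h` with `f = v * h`. Irreducibility forces
one factor to be constant: `h` gives the whole ring, `v` gives the ideal of `f` again. -/
theorem IsIrreducible.isCoatom_span {f : SkewPolynomial K} (hf : IsIrreducible f) {d : ℕ}
    (hd : f.degree = (d : WithBot ℕ)) (hd0 : d ≠ 0) :
    IsCoatom (Ideal.span {f} : Ideal (SkewPolynomial K)) := by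
  obtain ⟨hfd, hf0⟩ := degree_eq_coe_iff.1 hd
  constructor
  · intro htop
    obtain ⟨v, hv⟩ := Ideal.mem_span_singleton'.1 ((Ideal.eq_top_iff_one _).1 htop)
    have h1 : DegLT (v * f) d := by
      rw [hv]
      intro i hi
      rw [coeff_one, if_neg (by omega)]
    have := eq_zero_of_degLT_mul hfd hf0 h1
    rw [this, zero_mul] at hv
    exact zero_ne_one hv
  · intro J hJ
    have hfJ : f ∈ J := hJ.le (Ideal.mem_span_singleton_self f)
    obtain ⟨h, e, he, he1, rfl, -⟩ := exists_generator (J := J) hJ.ne_bot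
    obtain ⟨v, hv⟩ := Ideal.mem_span_singleton'.1 hfJ
    have he0 : h.coeff e ≠ 0 := by rw [he1]; exact one_ne_zero
    obtain ⟨a, hae, ha, ha0⟩ := exists_leading_of_eq_mul hfd hf0 he he0 hv.symm
    by_cases he' : e = 0
    · subst he'
      have : h = 1 := by rw [eq_C_of_degLT_one he, he1, C_1]
      rw [this, Ideal.span_singleton_one]
    by_cases ha' : a = 0
    · subst ha'
      refine absurd hJ (not_lt_of_ge ((Ideal.span_singleton_le_iff_mem _).2 ?_))
      refine Ideal.mem_span_singleton'.2 ⟨C (v.coeff 0)⁻¹, ?_⟩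
      rw [← hv, eq_C_of_degLT_one ha, coeff_C_zero, C_inv_mul_C_mul ha0]
    · refine absurd ⟨v, h, ?_, ?_, hv.symm⟩ hf
      · rw [hd]; exact degree_lt_iff.2 (ha.mono (by omega))
      · rw [hd]; exact degree_lt_iff.2 (he.mono (by omega))

/-- On a simple module `X` acts injectively or by zero. -/
theorem X_smul_injective_or {V : Type*} [AddCommGroup V] [Module (SkewPolynomial K) V]
    [IsSimpleModule (SkewPolynomial K) V] :
    (∀ v : V, (X : SkewPolynomial K) • v = 0 → v = 0) ∨
      ∀ v : V, (X : SkewPolynomial K) • v = 0 := by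
  -- Moving `X` past `r` only twists the coefficients of `r`, so the kernel of `X` is a submodule.
  have hX : ∀ r : SkewPolynomial K, ∃ s, X * r = s * X := fun r => ⟨_, X_mul⟩
  let N : Submodule (SkewPolynomial K) V :=
    { carrier := {v | (X : SkewPolynomial K) • v = 0}
      zero_mem' := smul_zero _
      add_mem' := fun {a b} ha hb => by
        simp only [Set.mem_ofPred_eq] at *
        rw [smul_add, ha, hb, add_zero]
      smul_mem' := fun r v hv => by
        simp only [Set.mem_ofPred_eq] at *
        obtain ⟨s, hs⟩ := hX r
        rw [smul_smul, hs, mul_smul, hv, smul_zero] }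
  rcases eq_bot_or_eq_top N with h | h
  · exact Or.inl fun v hv => (Submodule.mem_bot (SkewPolynomial K)).1 (h ▸ (show v ∈ N from hv))
  · exact Or.inr fun v => (h ▸ Submodule.mem_top : v ∈ N)

theorem mul_comm_of_fixed {p : SkewPolynomial K}
    (h1 : ∀ i, p.coeff i ≠ 0 → ∀ a : K, φ^[i] a = a) (h2 : ∀ i, φ (p.coeff i) = p.coeff i)
    (r : SkewPolynomial K) : p * r = r * p := by
  refine SkewPolynomial.ext fun k => ?_
  rw [coeff_mul_antidiagonal, coeff_mul_antidiagonal]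
  conv_lhs => rw [← Finset.HasAntidiagonal.map_swap_antidiagonal, Finset.sum_map]
  refine Finset.sum_congr rfl ?_
  rintro ⟨i, j⟩ -
  simp only [Function.Embedding.coeFn_mk, Prod.swap_prod_mk]
  rw [Function.iterate_fixed (h2 _)]
  by_cases h : p.coeff j = 0
  · simp [h]
  · rw [h1 _ h, mul_comm]

end Simple

/-! ### Endomorphisms of a cyclic module -/

section QuotientEnd

variable {R : Type*} [Ring R]

/-- An endomorphism is determined by the image of the class of 1, which may be any class killed by
`f`. -/
theorem card_end_quotient_span (f : R) :
    Nat.card (Module.End R (R ⧸ (Ideal.span {f} : Ideal R))) =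
      {v : R ⧸ (Ideal.span {f} : Ideal R) | f • v = 0}.ncard := by
  rw [← Nat.card_coe_set_eq]
  have hmk (r : R) : (Submodule.Quotient.mk r : R ⧸ (Ideal.span {f} : Ideal R)) =
      r • Submodule.Quotient.mk 1 := by
    rw [← Submodule.Quotient.mk_smul, smul_eq_mul, mul_one]
  refine Nat.card_congr (Equiv.ofBijective
    (fun g => (⟨g (Submodule.Quotient.mk 1), ?_⟩ :
      {v : R ⧸ (Ideal.span {f} : Ideal R) | f • v = 0})) ⟨?_, ?_⟩)
  · show f • g _ = 0
    rw [← map_smul, ← hmk, (Submodule.Quotient.mk_eq_zero _).2 (Ideal.mem_span_singleton_self f),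
      map_zero]
  · intro g g' h
    refine LinearMap.ext fun v => ?_
    obtain ⟨r, rfl⟩ := Submodule.Quotient.mk_surjective _ v
    rw [hmk, map_smul, map_smul]
    exact congrArg (r • ·) (congrArg Subtype.val h)
  · rintro ⟨v, hv⟩
    refine ⟨Submodule.liftQ _ (LinearMap.toSpanSingleton R _ v) ?_, Subtype.ext ?_⟩
    · refine Submodule.span_le.2 ?_
      rintro x rfl
      exact hv
    · show (LinearMap.toSpanSingleton R _ v) 1 = v
      simp

end QuotientEnd

/-! ### The order of σ, and linear maps over a finite division ring -/

section FixedField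

variable {K : Type*} [Field K] [Finite K]

/-- By Artin's theorem the degree of `K` over the fixed field is the order of the group generated by
`σ`. -/
theorem orderOf_eq_of_card (σ : K ≃+* K) {q n : ℕ}
    (hq : Nat.card (fixedSubfield σ) = q) (hn : Nat.card K = q ^ n) :
    1 < q ∧ orderOf (σ : RingAut K) = n := by
  have hq1 : 1 < q := hq ▸ Finite.one_lt_card
  refine ⟨hq1, ?_⟩
  let G := Subgroup.zpowers (σ : RingAut K)
  have : Finite (RingAut K) := Finite.of_injective (fun g : RingAut K => (g : K → K))
    DFunLike.coe_injective
  cases nonempty_fintype G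
  have h1 := FixedPoints.finrank_eq_card G K
  have h2 : FixedPoints.subfield G K = fixedSubfield σ := by
    ext a
    constructor
    · intro h
      exact h ⟨σ, Subgroup.mem_zpowers _⟩
    · intro h g
      have h' : (σ : RingAut K) ∈ MulAction.stabilizer (RingAut K) a := h
      exact (Subgroup.zpowers_le.2 h') g.2
  have h3 : Nat.card K = Nat.card (FixedPoints.subfield G K) ^
      Module.finrank (FixedPoints.subfield G K) K := Module.natCard_eq_pow_finrank
  rw [h1, h2, hq, hn, ← Nat.card_eq_fintype_card, Nat.card_zpowers] at h3
  exact (Nat.pow_right_injective hq1 h3).symm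

theorem iterate_eq_id_iff (σ : K ≃+* K) {q n : ℕ}
    (hq : Nat.card (fixedSubfield σ) = q) (hn : Nat.card K = q ^ n) (i : ℕ) :
    (∀ a, σ^[i] a = a) ↔ n ∣ i := by
  rw [← (orderOf_eq_of_card σ hq hn).2, orderOf_dvd_iff_pow_eq_one]
  have h : ∀ a, ((σ : RingAut K) ^ i) a = σ^[i] a := fun a => by
    induction i generalizing a with
    | zero => rfl
    | succ i ih => rw [pow_succ, Function.iterate_succ_apply, ← ih]; rfl
  constructor
  · intro h'
    exact RingEquiv.ext fun a => by rw [h, h' a]; rfl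
  · intro h' a
    rw [← h, h']; rfl

end FixedField

theorem card_module_end {D V : Type*} [DivisionRing D] [Finite D] [AddCommGroup V] [Module D V]
    [Finite V] : ∃ m, Nat.card V = Nat.card D ^ m ∧
      Nat.card (Module.End D V) = Nat.card D ^ (m * m) := by
  refine ⟨Module.finrank D V, Module.natCard_eq_pow_finrank, ?_⟩
  have b := Module.finBasis D V
  rw [← Nat.card_congr (b.constr ℕ (M' := V)).toEquiv, Nat.card_fun, Nat.card_fin,
    pow_mul, ← Module.natCard_eq_pow_finrank (K := D) (V := V)]

end SkewPolynomial

namespace SkewPolynomial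

/-! ### The annihilator of a simple module and the two counts -/

section Annihilator

variable {K : Type*} [Field K] [MulSemiringAction (Multiplicative ℕ) K]

theorem coeff_mul_C_sub_C_mul (p : SkewPolynomial K) (a b : K) (k : ℕ) :
    (p * C a - C b * p).coeff k = p.coeff k * φ^[k] a - b * p.coeff k := by
  rw [coeff_sub, coeff_mul_C, coeff_C_mul]

/-- The set of coefficients that a central element may have in degree `i`. -/
def centralCoeff (K : Type*) [Field K] [MulSemiringAction (Multiplicative ℕ) K] (i : ℕ) : Set K :=
  {a | (a ≠ 0 → ∀ b : K, φ^[i] b = b) ∧ φ a = a}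

variable {V : Type*} [AddCommGroup V] [Module (SkewPolynomial K) V]

/-- A generator of the annihilator of `V`, of least degree `e`. -/
structure IsAnnGenerator (V : Type*) [AddCommGroup V] [Module (SkewPolynomial K) V]
    (h : SkewPolynomial K) (e : ℕ) : Prop where
  degLT : DegLT h (e + 1)
  coeff_eq_one : h.coeff e = 1
  smul_eq_zero : ∀ v : V, h • v = 0
  eq_zero : ∀ p : SkewPolynomial K, (∀ v : V, p • v = 0) → DegLT p e → p = 0

/-- A finite `V` has finitely many self-maps, so two distinct powers of `X` act alike and their
difference annihilates `V`. -/
theorem exists_isAnnGenerator [Finite K] [Finite V] :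
    ∃ (h : SkewPolynomial K) (e : ℕ), IsAnnGenerator V h e := by
  have hJ : Module.annihilator (SkewPolynomial K) V ≠ ⊥ := by
    intro hbot
    have hinj : Function.Injective fun (i : ℕ) (v : V) =>
        (monomial i (1 : K) : SkewPolynomial K) • v := by
      intro i j hij
      have hm : (monomial i (1 : K) - monomial j (1 : K) : SkewPolynomial K) ∈
          Module.annihilator (SkewPolynomial K) V := by
        refine Module.mem_annihilator.2 fun v => ?_
        rw [sub_smul, sub_eq_zero]
        exact congrFun hij v
      rw [hbot, Submodule.mem_bot, sub_eq_zero] at hm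
      exact (monomial_left_inj one_ne_zero).1 hm
    exact not_finite_iff_infinite.2 (Infinite.of_injective _ hinj) (inferInstance : Finite (V → V))
  obtain ⟨h, e, he, he1, hspan, hmin⟩ := exists_generator hJ
  refine ⟨h, e, he, he1, ?_, fun p hp hd => hmin p (Module.mem_annihilator.2 hp) hd⟩
  exact Module.mem_annihilator.1 (hspan ▸ Ideal.mem_span_singleton_self h)

namespace IsAnnGenerator

variable {h : SkewPolynomial K} {e : ℕ}

/-- If `h = v * X`, then, `X` being surjective on the finite `V`, already `v` annihilates `V`,
against the minimality of `e`. -/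
theorem coeff_zero_ne_zero [Finite V] (H : IsAnnGenerator V h e)
    (hX : ∀ v : V, (X : SkewPolynomial K) • v = 0 → v = 0) : h.coeff 0 ≠ 0 := by
  intro h0
  have hX1 : DegLT (X : SkewPolynomial K) (1 + 1) := fun i hi => coeff_X_of_ne_one (by omega)
  obtain ⟨v, r, hv, hr⟩ := exists_eq_mul_add hX1 (by rw [coeff_X_one]; exact one_ne_zero) h
  have hr0 : r = 0 := by
    rw [eq_C_of_degLT_one hr, show r.coeff 0 = 0 from ?_, C_0]
    rw [hv, coeff_add, coeff_mul_X_zero, zero_add] at h0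
    exact h0
  rw [hr0, add_zero] at hv
  have hsurj : Function.Surjective fun w : V => (X : SkewPolynomial K) • w := by
    refine Finite.surjective_of_injective fun w w' hw => ?_
    refine sub_eq_zero.1 (hX _ ?_)
    rw [smul_sub, sub_eq_zero]
    exact hw
  have hvd : DegLT v e := fun i hi => by
    rw [← coeff_mul_X_succ, ← hv]
    exact H.degLT _ (by omega)
  have hv0 : v = 0 := H.eq_zero v (fun w => by
    obtain ⟨w, rfl⟩ := hsurj w
    show v • (X : SkewPolynomial K) • w = 0
    rw [smul_smul, ← hv, H.smul_eq_zero]) hvd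
  have h1 := H.coeff_eq_one
  rw [hv, hv0, zero_mul] at h1
  exact zero_ne_one h1

/-- The annihilator is two-sided, and the twist by `φ^[e]` cancels the leading terms; the constant
term of the resulting zero polynomial gives the claim. -/
theorem iterate_degree_eq (H : IsAnnGenerator V h e) (h0 : h.coeff 0 ≠ 0) (a : K) :
    φ^[e] a = a := by
  have h1 : h * C a - C (φ^[e] a) * h = 0 := by
    refine H.eq_zero _ (fun v => ?_) (DegLT.of_succ (fun i hi => ?_) ?_)
    · rw [sub_smul, mul_smul, mul_smul, H.smul_eq_zero, H.smul_eq_zero, smul_zero, sub_zero]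
    · rw [coeff_mul_C_sub_C_mul, H.degLT i hi, zero_mul, mul_zero, sub_zero]
    · rw [coeff_mul_C_sub_C_mul, H.coeff_eq_one, one_mul, mul_one, sub_self]
  have h2 := coeff_mul_C_sub_C_mul h a (φ^[e] a) 0
  rw [h1, coeff_zero, Function.iterate_zero, id, mul_comm, ← sub_mul] at h2
  exact (sub_eq_zero.1 ((mul_eq_zero.1 h2.symm).resolve_right h0)).symm

theorem exists_smul_eq (H : IsAnnGenerator V h e) (g : SkewPolynomial K) :
    ∃ p : SkewPolynomial K, DegLT p e ∧ ∀ v : V, p • v = g • v := by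
  obtain ⟨u, p, hg, hp⟩ := exists_eq_mul_add H.degLT
    (by rw [H.coeff_eq_one]; exact one_ne_zero) g
  refine ⟨p, hp, fun v => ?_⟩
  rw [hg, add_smul, mul_smul, H.smul_eq_zero, smul_zero, zero_add]

theorem eq_of_smul_eq (H : IsAnnGenerator V h e) {p r : SkewPolynomial K} (hp : DegLT p e)
    (hr : DegLT r e) (hpr : ∀ v : V, p • v = r • v) : p = r :=
  sub_eq_zero.1 <| H.eq_zero _ (fun v => by rw [sub_smul, hpr, sub_self]) (hp.sub hr)

/-- An element of degree less than `e` acting on `V` by a central operator has central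
coefficients. -/
theorem coeff_mem_centralCoeff (H : IsAnnGenerator V h e) (h0 : h.coeff 0 ≠ 0)
    {p : SkewPolynomial K} (hp : DegLT p e)
    (hc : ∀ (r : SkewPolynomial K) (v : V), p • r • v = r • p • v) (i : ℕ) :
    p.coeff i ∈ centralCoeff K i := by
  constructor
  · intro hi b
    have h1 : p * C b - C b * p = 0 := by
      refine H.eq_zero _ (fun v => ?_) (fun i hi => ?_)
      · rw [sub_smul, mul_smul, mul_smul, hc, sub_self]
      · rw [coeff_mul_C_sub_C_mul, hp i hi, zero_mul, mul_zero, sub_zero]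
    have h2 := coeff_mul_C_sub_C_mul p b b i
    rw [h1, coeff_zero, mul_comm, ← sub_mul] at h2
    exact sub_eq_zero.1 ((mul_eq_zero.1 h2.symm).resolve_right hi)
  · set g := X * p - p * X with hg
    have hg0 : g.coeff 0 = 0 := by rw [hg, coeff_sub, coeff_X_mul_zero, coeff_mul_X_zero, sub_zero]
    have hgs (j : ℕ) : g.coeff (j + 1) = φ (p.coeff j) - p.coeff j := by
      rw [hg, coeff_sub, coeff_X_mul_succ, coeff_mul_X_succ]
    have hgd : DegLT g (e + 1) := fun j hj => by
      obtain ⟨j, rfl⟩ := Nat.exists_eq_succ_of_ne_zero (by omega : j ≠ 0)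
      rw [Nat.succ_eq_add_one, hgs, hp j (by omega), map_zero, sub_zero]
    -- The commutator `g` annihilates `V` but may have degree `e`, so it is a constant multiple of
    -- `h`. Its constant term vanishes and that of `h` does not, so `g = 0`.
    have h1 : g - C (g.coeff e) * h = 0 := by
      refine H.eq_zero _ (fun v => ?_) (DegLT.of_succ (fun j hj => ?_) ?_)
      · rw [sub_smul, mul_smul, H.smul_eq_zero, smul_zero, hg, sub_smul, mul_smul, mul_smul, hc,
          sub_self, sub_zero]
      · rw [coeff_sub, coeff_C_mul, hgd j hj, H.degLT j hj, mul_zero, sub_zero]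
      · rw [coeff_sub, coeff_C_mul, H.coeff_eq_one, mul_one, sub_self]
    have h2 : g.coeff e * h.coeff 0 = 0 := by
      rw [← coeff_C_mul, ← sub_eq_zero.1 h1, hg0]
    rw [(mul_eq_zero.1 h2).resolve_right h0, C_0, zero_mul, sub_zero] at h1
    have h3 := hgs i
    rw [h1, coeff_zero] at h3
    exact (sub_eq_zero.1 h3.symm)

/-- Since `V` is finite, density realizes every map linear over the endomorphism ring by one ring
element, which may be reduced modulo `h`. -/
theorem card_end_end [Finite V] [IsSimpleModule (SkewPolynomial K) V]
    (H : IsAnnGenerator V h e) :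
    Nat.card (Module.End (Module.End (SkewPolynomial K) V) V) = Nat.card K ^ e := by
  cases nonempty_fintype V
  rw [← ncard_degLT, ← Nat.card_coe_set_eq]
  refine (Nat.card_congr (Equiv.ofBijective (fun p : {p : SkewPolynomial K | DegLT p e} =>
    Module.toModuleEnd (Module.End (SkewPolynomial K) V) (S := SkewPolynomial K) V p.1)
      ⟨?_, ?_⟩)).symm
  · rintro ⟨p, hp⟩ ⟨r, hr⟩ hpr
    exact Subtype.ext (H.eq_of_smul_eq hp hr fun v => LinearMap.congr_fun hpr v)
  · intro g
    obtain ⟨r, hr⟩ := jacobson_density (R := SkewPolynomial K) g Finset.univ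
    obtain ⟨p, hp, hpr⟩ := H.exists_smul_eq r
    exact ⟨⟨p, hp⟩, LinearMap.ext fun v => (hpr v).trans (hr v (Finset.mem_univ v)).symm⟩

/-- Commutativity makes each endomorphism linear over the endomorphism ring itself, so density
realizes it by a polynomial, which is then central. Conversely, central polynomials act by
endomorphisms. -/
theorem card_end [Finite V] [IsSimpleModule (SkewPolynomial K) V]
    (H : IsAnnGenerator V h e) (h0 : h.coeff 0 ≠ 0)
    (hcomm : ∀ g g' : Module.End (SkewPolynomial K) V, g * g' = g' * g) :
    Nat.card (Module.End (SkewPolynomial K) V) =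
      ∏ i ∈ Finset.range e, (centralCoeff K i).ncard := by
  cases nonempty_fintype V
  rw [← ncard_degLT_coeff, ← Nat.card_coe_set_eq]
  have hcoeff {p : SkewPolynomial K} (hp : DegLT p e ∧ ∀ i < e, p.coeff i ∈ centralCoeff K i)
      (i : ℕ) : p.coeff i ∈ centralCoeff K i := by
    rcases lt_or_ge i e with hi | hi
    · exact hp.2 i hi
    · rw [hp.1 i hi]
      exact ⟨fun h => absurd rfl h, map_zero _⟩
  refine (Nat.card_congr (Equiv.ofBijective
    (fun p : {p : SkewPolynomial K | DegLT p e ∧ ∀ i < e, p.coeff i ∈ centralCoeff K i} =>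
      ({ toFun := fun v => p.1 • v
         map_add' := smul_add _
         map_smul' := fun r v => by
          rw [smul_smul, mul_comm_of_fixed (fun i => (hcoeff p.2 i).1)
            (fun i => (hcoeff p.2 i).2), mul_smul]
          rfl } : Module.End (SkewPolynomial K) V)) ⟨?_, ?_⟩)).symm
  · rintro ⟨p, hp⟩ ⟨r, hr⟩ hpr
    exact Subtype.ext (H.eq_of_smul_eq hp.1 hr.1 fun v => LinearMap.congr_fun hpr v)
  · intro g
    let g' : Module.End (Module.End (SkewPolynomial K) V) V :=
      { toFun := g
        map_add' := map_add g
        map_smul' := fun k v => LinearMap.congr_fun (hcomm g k) v }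
    obtain ⟨r, hr⟩ := jacobson_density (R := SkewPolynomial K) g' Finset.univ
    obtain ⟨p, hp, hpr⟩ := H.exists_smul_eq r
    have hpg (v : V) : p • v = g v := (hpr v).trans (hr v (Finset.mem_univ v)).symm
    refine ⟨⟨p, hp, fun i _ => H.coeff_mem_centralCoeff h0 hp (fun r v => ?_) i⟩,
      LinearMap.ext hpg⟩
    rw [hpg, hpg, map_smul]

end IsAnnGenerator

/-- Degrees divisible by `n` allow the `q` fixed elements, all others only 0, so each block of `n`
degrees contributes `q`. -/
theorem prod_centralCoeff (σ : K ≃+* K) [Finite K] {q n : ℕ}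
    (hq : Nat.card (fixedSubfield σ) = q) (hn : Nat.card K = q ^ n)
    (hσ : ∀ a : K, φ a = σ a) (hn0 : 0 < n) (l : ℕ) :
    ∏ i ∈ Finset.range (n * l), (centralCoeff K i).ncard = q ^ l := by
  have hφσ : ((φ : K →+* K) : K → K) = σ := funext hσ
  have hS (i : ℕ) : (centralCoeff K i).ncard = if n ∣ i then q else 1 := by
    split_ifs with hi
    · rw [← hq, ← SetLike.coe_sort_coe, Nat.card_coe_set_eq]
      congr 1
      ext a
      exact ⟨fun h => (hσ a).symm.trans h.2, fun h => ⟨fun _ => by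
        rw [hφσ]; exact (iterate_eq_id_iff σ hq hn i).2 hi, (hσ a).trans h⟩⟩
    · rw [← Set.ncard_singleton (0 : K)]
      congr 1
      ext a
      refine ⟨fun h => ?_, ?_⟩
      · by_contra ha
        refine hi ((iterate_eq_id_iff σ hq hn i).1 ?_)
        rw [← hφσ]
        exact h.1 ha
      · rintro rfl
        exact ⟨fun h => absurd rfl h, map_zero _⟩
  simp only [hS]
  induction l with
  | zero => simp
  | succ l ih =>
    rw [Nat.mul_succ, Finset.prod_range_add, ih, pow_succ]
    congr 1
    rw [Finset.prod_eq_single_of_mem 0 (Finset.mem_range.2 hn0)]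
    · simp
    · intro j hj hj0
      rw [if_neg]
      rw [Nat.dvd_add_right (Nat.dvd_mul_right n l)]
      exact Nat.not_dvd_of_pos_of_lt (Nat.pos_of_ne_zero hj0) (Finset.mem_range.1 hj)

/-- If `X` acts injectively on the simple module `V`, then the order of `V` is the `n`-th power
of the order of its endomorphism ring. -/
theorem card_eq_card_end_pow (σ : K ≃+* K) [Finite K] {q n : ℕ}
    (hq : Nat.card (fixedSubfield σ) = q) (hn : Nat.card K = q ^ n)
    (hσ : ∀ a : K, φ a = σ a) [Finite V] [IsSimpleModule (SkewPolynomial K) V]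
    (hX : ∀ v : V, (X : SkewPolynomial K) • v = 0 → v = 0) :
    Nat.card V = Nat.card (Module.End (SkewPolynomial K) V) ^ n := by
  classical
  obtain ⟨h, e, H⟩ := exists_isAnnGenerator (K := K) (V := V)
  have h0 := H.coeff_zero_ne_zero hX
  have hφσ : ((φ : K →+* K) : K → K) = σ := funext hσ
  obtain ⟨l, rfl⟩ : n ∣ e := by
    refine (iterate_eq_id_iff σ hq hn e).1 ?_
    rw [← hφσ]
    exact H.iterate_degree_eq h0
  have hq1 : 1 < q := (orderOf_eq_of_card σ hq hn).1
  have hn0 : 0 < n := by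
    rcases Nat.eq_zero_or_pos n with rfl | hn0
    · have : 1 < Nat.card K := Finite.one_lt_card
      simp [hn] at this
    · exact hn0
  have : Finite (Module.End (SkewPolynomial K) V) :=
    Finite.of_injective (fun g => (g : V → V)) DFunLike.coe_injective
  have hcomm (g g' : Module.End (SkewPolynomial K) V) : g * g' = g' * g :=
    (littleWedderburn (Module.End (SkewPolynomial K) V)).mul_comm g g'
  have hD := H.card_end h0 hcomm
  rw [prod_centralCoeff σ hq hn hσ hn0] at hD
  have hA := H.card_end_end
  obtain ⟨m, hm, hm2⟩ := card_module_end (D := Module.End (SkewPolynomial K) V) (V := V)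
  -- Both counts of the double endomorphism ring as powers of `q`: `n * (n * l)` against `l * (m *
  -- m)`.
  rw [hA, hD, hn, ← pow_mul, ← pow_mul] at hm2
  have hl : l ≠ 0 := by
    rintro rfl
    have : 1 < Nat.card (Module.End (SkewPolynomial K) V) := Finite.one_lt_card
    rw [hD] at this
    simp at this
  have h1 : l * (n * n) = l * (m * m) := by
    rw [← Nat.pow_right_injective hq1 hm2]; ring
  rw [Nat.mul_self_inj.1 (Nat.eq_of_mul_eq_mul_left (Nat.pos_of_ne_zero hl) h1)]
  exact hm

end Annihilator

end SkewPolynomial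

/-! ### The order of the eigenring -/

/-- The action of `Multiplicative ℕ` on `K` in which the generator acts as `σ` makes
`SkewPolynomial K` the ring `K[t;σ]`, with `t = X` and `t a = σ(a) t`. -/
theorem mainTheorem6 {K : Type*} [Field K] [Finite K] (σ : K ≃+* K) (q n : ℕ)
    (hq : Nat.card (SkewPolynomial.fixedSubfield σ) = q) (hn : Nat.card K = q ^ n)
    [MulSemiringAction (Multiplicative ℕ) K]
    (hσ : ∀ a : K, SkewPolynomial.φ a = σ a)
    (d : ℕ) (f : SkewPolynomial K) (hf : SkewPolynomial.IsIrreducible f)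
    (hd : f.degree = (d : WithBot ℕ))
    (ht : 1 < n → ¬ SkewPolynomial.RightDvd SkewPolynomial.X f) :
    Set.ncard (SkewPolynomial.eigenring f) = q ^ d := by
  open SkewPolynomial in
  obtain ⟨hfd, hf0⟩ := degree_eq_coe_iff.1 hd
  have hφσ : ((φ : K →+* K) : K → K) = σ := funext hσ
  have hEmem (u : SkewPolynomial K) : u ∈ eigenring f ↔ DegLT u d ∧ SkewPolynomial.RightDvd f (f * u) := by
    rw [← degree_lt_iff, ← hd]; rfl
  by_cases hn1 : n ≤ 1
  · have hone : n = 1 := by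
      have h1 : 1 < Nat.card K := Finite.one_lt_card
      rcases Nat.eq_zero_or_pos n with rfl | hn0
      · simp [hn] at h1
      · omega
    subst hone
    have hid (i : ℕ) (a : K) : φ^[i] a = a := by
      rw [hφσ]
      exact (iterate_eq_id_iff σ hq hn i).2 (one_dvd i) a
    rw [show eigenring f = {u | DegLT u d} from ?_, ncard_degLT, hn, pow_one]
    ext u
    rw [hEmem]
    exact ⟨fun h => h.1, fun h => ⟨h, u, mul_comm_of_fixed (fun i _ => hid i)
      (fun i => hid 1 _) u⟩⟩
  -- For `d = 0` the quotient is zero and hence not simple, but only `u = 0` has degree below 0.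
  · by_cases hd0 : d = 0
    · subst hd0
      rw [pow_zero, Set.ncard_eq_one]
      refine ⟨0, Set.ext fun u => ?_⟩
      rw [hEmem]
      refine ⟨fun h => h.1.eq_zero, ?_⟩
      rintro rfl
      exact ⟨fun i _ => coeff_zero i, 0, by rw [mul_zero, zero_mul]⟩
    have := isSimpleModule_iff_isCoatom.2 (hf.isCoatom_span hd hd0)
    have hcard := card_quotient_span hfd hf0
    have : Finite (SkewPolynomial K ⧸ (Ideal.span {f} : Ideal (SkewPolynomial K))) := by
      refine Nat.finite_of_card_ne_zero ?_
      rw [hcard]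
      exact pow_ne_zero _ Nat.card_pos.ne'
    have hE : (eigenring f).ncard = Nat.card (Module.End (SkewPolynomial K)
        (SkewPolynomial K ⧸ (Ideal.span {f} : Ideal (SkewPolynomial K)))) := by
      have hbij := bijOn_degLT_quotient hfd hf0
      have hmk (u : SkewPolynomial K) : SkewPolynomial.RightDvd f (f * u) ↔
        f • (Submodule.Quotient.mk u :
          SkewPolynomial K ⧸ (Ideal.span {f} : Ideal (SkewPolynomial K))) = 0 := by
        rw [← Submodule.Quotient.mk_smul, Submodule.Quotient.mk_eq_zero,
          Ideal.mem_span_singleton']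
        exact exists_congr fun v => eq_comm
      rw [card_end_quotient_span, ← (hbij.injOn.mono fun u hu => ((hEmem u).1 hu).1).ncard_image]
      congr 1
      ext v
      constructor
      · rintro ⟨u, hu, rfl⟩
        exact (hmk u).1 ((hEmem u).1 hu).2
      · intro hv
        obtain ⟨u, hu, rfl⟩ := hbij.surjOn (Set.mem_univ v)
        exact ⟨u, (hEmem u).2 ⟨hu, (hmk u).2 hv⟩, rfl⟩
    have hX := (X_smul_injective_or (K := K)
      (V := SkewPolynomial K ⧸ (Ideal.span {f} : Ideal (SkewPolynomial K)))).resolve_right ?_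
    · have h1 := card_eq_card_end_pow σ hq hn hσ hX
      -- This is `q^(dn) = |E(f)|^n`, from which the `n`-th root is taken.
      rw [hcard, hn, ← hE, ← pow_mul, mul_comm, pow_mul] at h1
      exact (Nat.pow_left_injective (by omega : n ≠ 0) h1).symm
    · intro h0
      have h1 := h0 (Submodule.Quotient.mk 1)
      rw [← Submodule.Quotient.mk_smul, Submodule.Quotient.mk_eq_zero, smul_eq_mul, mul_one,
        Ideal.mem_span_singleton'] at h1
      obtain ⟨v, hv⟩ := h1
      have hX1 : DegLT (X : SkewPolynomial K) (1 + 1) := fun i hi => coeff_X_of_ne_one (by omega)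
      obtain ⟨a, had, ha, ha0⟩ := exists_leading_of_eq_mul hX1
        (by rw [coeff_X_one]; exact one_ne_zero) hfd hf0 hv.symm
      -- If `X` killed the quotient, then `X = v * f`; since `a + d = 1` and `d ≠ 0`, `v` is a
      -- nonzero constant and `X` right-divides `f`.
      obtain rfl : a = 0 := by omega
      refine ht (by omega) ⟨C (v.coeff 0)⁻¹, ?_⟩
      rw [← hv, eq_C_of_degLT_one ha, coeff_C_zero, C_inv_mul_C_mul ha0]
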